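/- A skew (left) brace is a set $B$ with two group structures $(B,+)$ and $(B,\cdot)$, neither assumed commutative, such that $a(b+c)=ab-a+ac$ for all $a,b,c\in B$; the two identity elements then coincide and are denoted by $0$. Put $\lambda_a(b)=-a+ab$ and $a*b=-a+ab-b$. An ideal of $B$ is a subset that is a normal subgroup of both $(B,+)$ and $(B,\cdot)$ and is invariant under all maps $\lambda_b$, $b\in B$; the quotient of $B$ by an ideal is again a skew brace. Let $$\operatorname{Soc}(B)=\operatorname{Ker}\lambda\cap Z(B,+),\qquad \zeta(B)=\operatorname{Soc}(B)\cap Z(B,\cdot),$$ where $Z$ denotes the centre of a group; $\zeta(B)$ is an ideal of $B$. The upper central series of $B$ is given by $\zeta_0(B)=\{0\}$ and $\zeta_{n+1}(B)/\zeta_n(B)=\zeta\big(B/\zeta_n(B)\big)$ for $n\ge 0$. The lower central series is given by $\Gamma_1(B)=B$ and, for $n\geq 1$, by letting $\Gamma_{n+1}(B)$ be the subgroup of $(B,+)$ generated by all elements $x*b$, $b*x$ and $x+b-x-b$ with $x\in\Gamma_n(B)$ and $b\in B$. The skew brace $B$ is supersoluble if it has a finite chain of ideals $\{0\}=I_0\leq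 I_1\leq\dots\leq I_m=B$ such that, for each $0\le i<m$, either $(I_{i+1}/I_i,+)$ is infinite cyclic and $I_{i+1}/I_i\leq\operatorname{Soc}(B/I_i)$, or $I_{i+1}/I_i$ has prime order. **Theorem.** Let $B$ be a supersoluble skew brace, and let $n\geq 0$ be an integer such that $B/\zeta_n(B)$ is finite. Then $\Gamma_{n+1}(B)$ is finite. -/

import Mathlib

/-- A skew left brace: a set with two (not necessarily commutative) group structures
`(B, +)` and `(B, *)` such that `a * (b + c) = a * b - a + a * c`. The two identity elements
`0` and `1` then coincide (`SkewBrace.one_eq_zero`). -/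
class SkewBrace (B : Type*) extends Group B, AddGroup B where
  mul_add_brace : ∀ a b c : B, a * (b + c) = a * b - a + a * c

namespace SkewBrace

variable {B : Type*} [SkewBrace B]

theorem one_eq_zero : (1 : B) = 0 := by
  have h := mul_add_brace (1 : B) 0 0
  simp only [one_mul, add_zero, zero_sub] at h
  exact (neg_eq_zero.mp h.symm)

/-- The map `lam a b = λ_a(b) = -a + a b`. -/
def lam (a b : B) : B := -a + a * b

/-- The star operation `a ∗ b = -a + a b - b`. -/
def star (a b : B) : B := -a + a * b - b

theorem mul_eq (a b : B) : a * b = a + lam a b := by simp [lam]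

theorem mul_zero' (a : B) : a * (0 : B) = a := by
  rw [← one_eq_zero, mul_one]

theorem lam_one (b : B) : lam 1 b = b := by
  simp [lam, one_eq_zero (B := B)]

theorem lam_add (a b c : B) : lam a (b + c) = lam a b + lam a c := by
  simp [lam, mul_add_brace, sub_eq_add_neg, add_assoc]

theorem lam_zero (a : B) : lam a 0 = 0 := by
  simp [lam, mul_zero']

theorem lam_neg (a b : B) : lam a (-b) = -lam a b := by
  rw [eq_neg_iff_add_eq_zero, ← lam_add, neg_add_cancel, lam_zero]

theorem lam_mul (a b c : B) : lam (a * b) c = lam a (lam b c) := by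
  have h : lam a (-b + b * c) = lam a (-b) + lam a (b * c) := lam_add _ _ _
  rw [lam_neg] at h
  change _ = lam a (-b + b * c)
  rw [h]
  simp [lam, mul_assoc, add_assoc]

end SkewBrace

open SkewBrace in
/-- An ideal of a skew brace: a subgroup of both `(B, +)` and `(B, *)` which is invariant under
all the maps `λ_b` and is normal in both groups. -/
structure BraceIdeal (B : Type*) [SkewBrace B] extends AddSubgroup B where
  one_mem : (1 : B) ∈ carrier
  mul_mem : ∀ {x y : B}, x ∈ carrier → y ∈ carrier → x * y ∈ carrier
  inv_mem : ∀ {x : B}, x ∈ carrier → x⁻¹ ∈ carrier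
  lam_mem : ∀ (b : B) {x : B}, x ∈ carrier → lam b x ∈ carrier
  add_conj_mem : ∀ (b : B) {x : B}, x ∈ carrier → b + x - b ∈ carrier
  mul_conj_mem : ∀ (b : B) {x : B}, x ∈ carrier → b * x * b⁻¹ ∈ carrier

namespace BraceIdeal

open SkewBrace

variable {B : Type*} [SkewBrace B]

instance normal (I : BraceIdeal B) : I.toAddSubgroup.Normal :=
  ⟨fun x hx b => by simpa [sub_eq_add_neg] using I.add_conj_mem b hx⟩

/-- Additive and multiplicative left cosets of an ideal coincide. -/
theorem neg_add_mem_iff (I : BraceIdeal B) (a b : B) :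
    -a + b ∈ I.toAddSubgroup ↔ a⁻¹ * b ∈ I.toAddSubgroup := by
  have e : -a + b = lam a (a⁻¹ * b) := by simp [lam]
  constructor
  · intro h
    have h2 := I.lam_mem a⁻¹ h
    rw [e, ← lam_mul, inv_mul_cancel, lam_one] at h2
    exact h2
  · intro h
    rw [e]
    exact I.lam_mem a h

/-- The underlying set of the quotient brace `B / I`, i.e. the set of cosets `b + I = b I`. -/
def Quotient (I : BraceIdeal B) : Type _ := B ⧸ I.toAddSubgroup

instance (I : BraceIdeal B) : AddGroup I.Quotient :=
  inferInstanceAs (AddGroup (B ⧸ I.toAddSubgroup))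

/-- The projection `B → B / I`, as a homomorphism of additive groups. -/
def proj (I : BraceIdeal B) : B →+ I.Quotient := QuotientAddGroup.mk' I.toAddSubgroup

theorem proj_eq_iff (I : BraceIdeal B) {a b : B} :
    I.proj a = I.proj b ↔ a⁻¹ * b ∈ I.toAddSubgroup := by
  rw [← neg_add_mem_iff]
  exact QuotientAddGroup.eq

theorem proj_surjective (I : BraceIdeal B) : Function.Surjective I.proj :=
  QuotientAddGroup.mk'_surjective _

theorem proj_mul_congr (I : BraceIdeal B) {a a' b b' : B} (ha : I.proj a = I.proj a')
    (hb : I.proj b = I.proj b') : I.proj (a * b) = I.proj (a' * b') := by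
  rw [proj_eq_iff] at *
  have h1 := I.mul_mem (I.mul_conj_mem b⁻¹ ha) hb
  have e : b⁻¹ * (a⁻¹ * a') * b⁻¹⁻¹ * (b⁻¹ * b') = (a * b)⁻¹ * (a' * b') := by group
  rw [e] at h1
  exact h1

theorem proj_inv_congr (I : BraceIdeal B) {a a' : B} (ha : I.proj a = I.proj a') :
    I.proj a⁻¹ = I.proj a'⁻¹ := by
  rw [proj_eq_iff] at *
  have h1 := I.mul_conj_mem a (I.inv_mem ha)
  have e : a * (a⁻¹ * a')⁻¹ * a⁻¹ = a⁻¹⁻¹ * a'⁻¹ := by group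
  rw [e] at h1
  exact h1

instance (I : BraceIdeal B) : Mul I.Quotient where
  mul := Quotient.map₂ (· * ·) fun _ _ ha _ _ hb => _root_.Quotient.exact
    (I.proj_mul_congr (_root_.Quotient.sound ha) (_root_.Quotient.sound hb))

instance (I : BraceIdeal B) : Inv I.Quotient where
  inv := Quotient.map (·⁻¹) fun _ _ ha => _root_.Quotient.exact
    (I.proj_inv_congr (_root_.Quotient.sound ha))

instance (I : BraceIdeal B) : One I.Quotient := ⟨I.proj 1⟩

theorem proj_mul (I : BraceIdeal B) (a b : B) : I.proj (a * b) = I.proj a * I.proj b := rfl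

theorem proj_inv (I : BraceIdeal B) (a : B) : I.proj a⁻¹ = (I.proj a)⁻¹ := rfl

theorem proj_one (I : BraceIdeal B) : I.proj 1 = 1 := rfl

/-- The quotient brace `B / I`; its operations are induced by those of `B`. -/
instance (I : BraceIdeal B) : SkewBrace I.Quotient where
  toGroup :=
    { mul_assoc := fun x y z => by
        obtain ⟨a, rfl⟩ := I.proj_surjective x
        obtain ⟨b, rfl⟩ := I.proj_surjective y
        obtain ⟨c, rfl⟩ := I.proj_surjective z
        simp only [← proj_mul, mul_assoc]
      one_mul := fun x => by
        obtain ⟨a, rfl⟩ := I.proj_surjective x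
        rw [← proj_one, ← proj_mul, one_mul]
      mul_one := fun x => by
        obtain ⟨a, rfl⟩ := I.proj_surjective x
        rw [← proj_one, ← proj_mul, mul_one]
      inv_mul_cancel := fun x => by
        obtain ⟨a, rfl⟩ := I.proj_surjective x
        rw [← proj_inv, ← proj_mul, inv_mul_cancel, proj_one] }
  toAddGroup := inferInstance
  mul_add_brace := fun x y z => by
    obtain ⟨a, rfl⟩ := I.proj_surjective x
    obtain ⟨b, rfl⟩ := I.proj_surjective y
    obtain ⟨c, rfl⟩ := I.proj_surjective z
    rw [← map_add, ← proj_mul, mul_add_brace, map_add, map_sub]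
    rfl

theorem proj_lam (I : BraceIdeal B) (a b : B) : I.proj (lam a b) = lam (I.proj a) (I.proj b) := by
  simp only [lam, map_add, map_neg]
  rfl

/-- The zero ideal `{0}`. -/
def zero (B : Type*) [SkewBrace B] : BraceIdeal B where
  toAddSubgroup := ⊥
  one_mem := one_eq_zero
  mul_mem := by
    rintro x y (rfl : x = 0) (rfl : y = 0)
    exact mul_zero' 0
  inv_mem := by
    rintro x (rfl : x = 0)
    change (0 : B)⁻¹ = 0
    rw [← one_eq_zero, inv_one]
  lam_mem := by
    rintro b x (rfl : x = 0)
    exact lam_zero b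
  add_conj_mem := by
    rintro b x (rfl : x = 0)
    change b + 0 - b = 0
    simp
  mul_conj_mem := by
    rintro b x (rfl : x = 0)
    change b * 0 * b⁻¹ = 0
    rw [mul_zero', mul_inv_cancel, one_eq_zero]

/-- The preimage in `B` of an ideal of `B / I`. -/
def comapProj (I : BraceIdeal B) (J : BraceIdeal I.Quotient) : BraceIdeal B where
  toAddSubgroup := J.toAddSubgroup.comap I.proj
  one_mem := J.one_mem
  mul_mem := fun {x y} hx hy => by
    change I.proj (x * y) ∈ J.toAddSubgroup
    rw [proj_mul]
    exact J.mul_mem hx hy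
  inv_mem := fun {x} hx => by
    change I.proj x⁻¹ ∈ J.toAddSubgroup
    rw [proj_inv]
    exact J.inv_mem hx
  lam_mem := fun b {x} hx => by
    change I.proj (lam b x) ∈ J.toAddSubgroup
    rw [proj_lam]
    exact J.lam_mem _ hx
  add_conj_mem := fun b {x} hx => by
    change I.proj (b + x - b) ∈ J.toAddSubgroup
    rw [map_sub, map_add]
    exact J.add_conj_mem _ hx
  mul_conj_mem := fun b {x} hx => by
    change I.proj (b * x * b⁻¹) ∈ J.toAddSubgroup
    rw [proj_mul, proj_mul, proj_inv]
    exact J.mul_conj_mem _ hx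

end BraceIdeal

namespace SkewBrace

variable (B : Type*) [SkewBrace B]

/-- `Soc(B) = Ker λ ∩ Z(B, +)`, as a set. -/
def socle : Set B :=
  {a : B | (∀ b : B, lam a b = b) ∧ (∀ b : B, a + b = b + a)}

/-- `ζ(B) = Soc(B) ∩ Z(B, *)`, as a set. -/
def centerSet : Set B :=
  {a : B | a ∈ socle B ∧ ∀ b : B, a * b = b * a}

variable {B}

theorem mul_eq_add_of_mem {a : B} (h : a ∈ centerSet B) (b : B) : a * b = a + b := by
  rw [mul_eq, h.1.1]

theorem lam_of_mem {a : B} (h : a ∈ centerSet B) (b : B) : lam b a = a := by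
  have h1 := mul_eq b a
  rw [← h.2, mul_eq_add_of_mem h, h.1.2] at h1
  exact (add_left_cancel h1).symm

theorem mul_mem_centerSet {x y : B} (hx : x ∈ centerSet B) (hy : y ∈ centerSet B) :
    x * y ∈ centerSet B := by
  refine ⟨⟨fun b => by rw [lam_mul, hy.1.1, hx.1.1], fun b => ?_⟩, fun b => ?_⟩
  · rw [mul_eq_add_of_mem hx, add_assoc, hy.1.2, ← add_assoc, hx.1.2, add_assoc]
  · rw [mul_assoc, hy.2, ← mul_assoc, hx.2, mul_assoc]

theorem inv_eq_neg_of_mem {x : B} (hx : x ∈ centerSet B) : x⁻¹ = -x := by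
  have h := mul_eq_add_of_mem hx x⁻¹
  rw [mul_inv_cancel, one_eq_zero] at h
  exact (neg_eq_of_add_eq_zero_right h.symm).symm

theorem inv_mem_centerSet {x : B} (hx : x ∈ centerSet B) : x⁻¹ ∈ centerSet B := by
  refine ⟨⟨fun b => ?_, fun b => ?_⟩, fun b => ?_⟩
  · conv_lhs => rw [← hx.1.1 b]
    rw [← lam_mul, inv_mul_cancel, lam_one]
  · rw [inv_eq_neg_of_mem hx]
    have h : AddCommute x b := hx.1.2 b
    exact h.neg_left
  · have h : Commute x b := hx.2 b
    exact h.inv_left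

theorem one_mem_centerSet : (1 : B) ∈ centerSet B :=
  ⟨⟨lam_one, fun b => by simp [one_eq_zero (B := B)]⟩, fun b => by simp⟩

/-- The centre `ζ(B) = Soc(B) ∩ Z(B, *)`, as an ideal of `B`. -/
def center (B : Type*) [SkewBrace B] : BraceIdeal B where
  carrier := centerSet B
  zero_mem' := by
    rw [← one_eq_zero]
    exact one_mem_centerSet
  add_mem' := fun {x y} hx hy => by
    rw [← mul_eq_add_of_mem hx]
    exact mul_mem_centerSet hx hy
  neg_mem' := fun {x} hx => by
    rw [← inv_eq_neg_of_mem hx]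
    exact inv_mem_centerSet hx
  one_mem := one_mem_centerSet
  mul_mem := mul_mem_centerSet
  inv_mem := inv_mem_centerSet
  lam_mem := fun b {x} hx => by
    rwa [lam_of_mem hx]
  add_conj_mem := fun b {x} hx => by
    rwa [← hx.1.2, add_sub_cancel_right]
  mul_conj_mem := fun b {x} hx => by
    rwa [← hx.2, mul_inv_cancel_right]

/-- The finite terms of the upper central series: `ζ_0(B) = {0}`, and `ζ_{n+1}(B)` is the ideal
with `ζ_{n+1}(B) / ζ_n(B) = ζ(B / ζ_n(B))`. -/
def zetaSeries (B : Type*) [SkewBrace B] : ℕ → BraceIdeal B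
  | 0 => BraceIdeal.zero B
  | n + 1 => (zetaSeries B n).comapProj (center (zetaSeries B n).Quotient)

/-- `X ∗ Y`: the subgroup of `(B, +)` generated by all `x ∗ y` with `x ∈ X` and `y ∈ Y`. -/
def starSubgroup (X Y : Set B) : AddSubgroup B :=
  AddSubgroup.closure {z : B | ∃ x ∈ X, ∃ y ∈ Y, star x y = z}

/-- The lower central series, indexed from `1`: `Γ_1(B) = B` and, for `n ≥ 1`, `Γ_{n+1}(B)` is the
subgroup of `(B, +)` generated by `Γ_n(B) ∗ B`, `B ∗ Γ_n(B)` and `[Γ_n(B), B]_+`. The index `0` is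
not used; there the value is `B`. -/
def gammaSeries (B : Type*) [SkewBrace B] : ℕ → AddSubgroup B
  | 0 => ⊤
  | 1 => ⊤
  | n + 2 =>
      starSubgroup (gammaSeries B (n + 1) : Set B) Set.univ ⊔
        starSubgroup Set.univ (gammaSeries B (n + 1) : Set B) ⊔
        ⁅gammaSeries B (n + 1), (⊤ : AddSubgroup B)⁆

/-- For ideals `I ≤ J`, the factor `J / I` as a subgroup of the additive group of `B / I`. -/
def factor (I J : BraceIdeal B) : AddSubgroup I.Quotient := J.toAddSubgroup.map I.proj

/-- `B` is supersoluble: there is a finite chain `{0} = I_0 ≤ I_1 ≤ ... ≤ I_n = B` of ideals of `B`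
such that each factor `I_{i+1} / I_i` either is additively infinite cyclic and contained in
`Soc(B / I_i)`, or has prime order. -/
def IsSupersoluble (B : Type*) [SkewBrace B] : Prop :=
  ∃ (n : ℕ) (I : ℕ → BraceIdeal B),
    (I 0).toAddSubgroup = ⊥ ∧ (I n).toAddSubgroup = ⊤ ∧
    ∀ i < n, (I i).toAddSubgroup ≤ (I (i + 1)).toAddSubgroup ∧
      ((IsAddCyclic (factor (I i) (I (i + 1))) ∧ Infinite (factor (I i) (I (i + 1))) ∧
          (factor (I i) (I (i + 1)) : Set (I i).Quotient) ⊆ socle (I i).Quotient) ∨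
        (Nat.card (factor (I i) (I (i + 1)))).Prime)

end SkewBrace

/-!
Supersolubility gives the maximal condition on subgroups of `(B, +)`, because the factors of the
chain are additively cyclic. By induction on `j`, the ideal `Γ_{j+1}(B)` is finite modulo
`ζ_{n-j}(B)`, and `j = n` is the theorem. The inductive step, applied in `B / ζ_{n-j-1}(B)`, is an
analogue of Schur's theorem: if an ideal `I` is finite modulo `ζ(B)`, then `[I, B]` is finite.

To prove the latter, put `k = |I : I ∩ ζ(B)|`. Multiplication by `k` is, by the transfer, an
additive homomorphism from `I` to `ζ(B)`. It kills every `b ∗ x` and `[x, b]₊` with `x ∈ I`, since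
`λ_b` and conjugation by `b` fix `k x`. Hence `x ↦ k (x ∗ b)` is a homomorphism from `(I, ·)` to
`(B, +)`. It kills the power of `x` that lies in `ζ(B)`, so `x ∗ b` has finite order. Thus `[I, B]`
is a torsion group that is finite modulo its centre, and the maximal condition makes it finite.
-/

/-- A Noetherian group, written additively: it satisfies the maximal condition on subgroups, in the
form that every subgroup is finitely generated. -/
def IsNoetherianAddGroup (G : Type*) [AddGroup G] : Prop :=
  ∀ H : AddSubgroup G, H.FG

section Noetherian

variable {G Q : Type*} [AddGroup G] [AddGroup Q]

theorem fg_of_fg_map_of_fg_inf_ker (f : G →+ Q) {H : AddSubgroup G} (hmap : (H.map f).FG)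
    (hker : (H ⊓ f.ker).FG) : H.FG := by
  obtain ⟨S, hS, hSfin⟩ := (AddSubgroup.fg_iff _).mp hmap
  have hSH : S ⊆ f '' H := by
    rw [← AddSubgroup.coe_map, ← hS]
    exact AddSubgroup.subset_closure
  obtain ⟨T, hTH, hTfin, rfl⟩ : ∃ T ⊆ (H : Set G), T.Finite ∧ S = f '' T :=
    Set.exists_subset_image_finite_and.mp ⟨S, hSH, hSfin, rfl⟩
  have hT : AddSubgroup.closure T ≤ H := (AddSubgroup.closure_le H).mpr hTH
  have hH : AddSubgroup.closure T ⊔ H ⊓ f.ker = H := by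
    refine le_antisymm (sup_le hT inf_le_left) fun x hx => ?_
    rw [← AddMonoidHom.map_closure] at hS
    obtain ⟨t, ht, htx⟩ : f x ∈ (AddSubgroup.closure T).map f :=
      hS ▸ AddSubgroup.mem_map_of_mem f hx
    have hdiff : -t + x ∈ H ⊓ f.ker :=
      ⟨H.add_mem (H.neg_mem (hT ht)) hx, by simp [htx]⟩
    simpa using AddSubgroup.add_mem_sup ht hdiff
  rw [← hH]
  exact ((AddSubgroup.fg_iff _).mpr ⟨T, rfl, hTfin⟩).sup hker

theorem fg_of_le_of_isAddCyclic {H C : AddSubgroup G} [IsAddCyclic C] (h : H ≤ C) : H.FG := by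
  have : IsAddCyclic H :=
    isAddCyclic_of_injective (AddSubgroup.inclusion h) (AddSubgroup.inclusion_injective h)
  obtain ⟨g, hg⟩ := H.isAddCyclic_iff_exists_zmultiples_eq_top.mp this
  exact ⟨{g}, by simpa [AddSubgroup.zmultiples_eq_closure] using hg⟩

theorem IsNoetherianAddGroup.of_surjective (hG : IsNoetherianAddGroup G) {f : G →+ Q}
    (hf : Function.Surjective f) : IsNoetherianAddGroup Q := fun H => by
  obtain ⟨S, hS, hSfin⟩ := (AddSubgroup.fg_iff _).mp (hG (H.comap f))
  refine (AddSubgroup.fg_iff _).mpr ⟨f '' S, ?_, hSfin.image f⟩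
  rw [← AddMonoidHom.map_closure, hS, AddSubgroup.map_comap_eq_self_of_surjective hf]

theorem finite_of_fg_of_le_center {H : AddSubgroup G} (hfg : H.FG)
    (hH : H ≤ AddSubgroup.center G) (htors : ∀ x ∈ H, IsOfFinAddOrder x) : Finite H := by
  let _ : AddCommGroup H :=
    { (inferInstance : AddGroup H) with
      add_comm := fun x y => Subtype.ext (AddSubgroup.mem_center_iff.mp (hH y.2) x) }
  have : AddGroup.FG H := (AddGroup.fg_iff_addSubgroup_fg H).mpr hfg
  exact AddCommGroup.finite_of_fg_isAddTorsion H fun x =>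
    AddSubmonoid.isOfFinAddOrder_coe.mp (htors x x.2)

theorem IsNoetherianAddGroup.finite_of_relIndex_ne_zero (hG : IsNoetherianAddGroup G)
    {H C : AddSubgroup G} (hC : C ≤ AddSubgroup.center G) (hindex : C.relIndex H ≠ 0)
    (htors : ∀ x ∈ H, IsOfFinAddOrder x) : Finite H := by
  have hinf : Finite ↥(H ⊓ C) :=
    finite_of_fg_of_le_center (hG _) (inf_le_right.trans hC) fun x hx => htors x hx.1
  have hcard : Nat.card ↥(H ⊓ C) * C.relIndex H = Nat.card H := by
    rw [← AddSubgroup.inf_relIndex_left, ← AddSubgroup.relIndex_bot_left,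
      AddSubgroup.relIndex_mul_relIndex _ _ _ bot_le inf_le_left, AddSubgroup.relIndex_bot_left]
  exact Nat.finite_of_card_ne_zero (hcard ▸ mul_ne_zero Nat.card_pos.ne' hindex)

end Noetherian

section CentralFiniteIndex

theorem mul_pow_index_of_le_center {G : Type*} [Group G] {H : Subgroup G}
    (hH : H ≤ Subgroup.center G) (x y : G) :
    (x * y) ^ H.index = x ^ H.index * y ^ H.index := by
  rcases eq_or_ne H.index 0 with h0 | h0
  · simp [h0]
  have : H.FiniteIndex := ⟨h0⟩
  have : (Subgroup.center G).FiniteIndex := Subgroup.finiteIndex_of_le hH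
  have hmul : (x * y) ^ (Subgroup.center G).index =
      x ^ (Subgroup.center G).index * y ^ (Subgroup.center G).index :=
    congrArg Subtype.val (map_mul (MonoidHom.transferCenterPow G) x y)
  have hcomm : Commute (x ^ (Subgroup.center G).index) (y ^ (Subgroup.center G).index) :=
    (Subgroup.mem_center_iff.mp ((Subgroup.center G).pow_index_mem x) _).symm
  rw [← Subgroup.relIndex_mul_index hH, mul_comm, pow_mul, hmul, hcomm.mul_pow, ← pow_mul,
    ← pow_mul]

variable {G : Type*} [AddGroup G] {C H : AddSubgroup G}

theorem relIndex_nsmul_add (hC : C ≤ AddSubgroup.center G) {x y : G} (hx : x ∈ H) (hy : y ∈ H) :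
    C.relIndex H • (x + y) = C.relIndex H • x + C.relIndex H • y := by
  have hle : (C.addSubgroupOf H).toSubgroup ≤ Subgroup.center (Multiplicative H) := fun z hz =>
    Subgroup.mem_center_iff.mpr fun w => Subtype.ext (AddSubgroup.mem_center_iff.mp (hC hz) _)
  exact congrArg Subtype.val (mul_pow_index_of_le_center hle (.ofAdd ⟨x, hx⟩) (.ofAdd ⟨y, hy⟩))

/-- The torsion elements of `H`, which form a subgroup when `H` has a subgroup of finite index that
is central in the ambient group. -/
def torsionOfLECenter [C.Normal] (hC : C ≤ AddSubgroup.center G) (hindex : C.relIndex H ≠ 0) :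
    AddSubgroup G where
  carrier := {x | x ∈ H ∧ IsOfFinAddOrder x}
  zero_mem' := ⟨H.zero_mem, IsOfFinAddOrder.zero⟩
  neg_mem' := fun hx => ⟨H.neg_mem hx.1, hx.2.neg⟩
  add_mem' := fun {x y} hx hy => by
    refine ⟨H.add_mem hx.1 hy.1, .of_nsmul ?_ hindex⟩
    have hcomm : AddCommute (C.relIndex H • x) (C.relIndex H • y) :=
      AddSubgroup.mem_center_iff.mp (hC (C.nsmul_relIndex_mem hy.1)) _
    rw [relIndex_nsmul_add hC hx.1 hy.1]
    exact hcomm.isOfFinAddOrder_add hx.2.nsmul hy.2.nsmul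

end CentralFiniteIndex

namespace BraceIdeal

variable {B : Type*} [SkewBrace B]

theorem ker_proj (I : BraceIdeal B) : I.proj.ker = I.toAddSubgroup :=
  QuotientAddGroup.ker_mk' _

theorem proj_star (I : BraceIdeal B) (a b : B) :
    I.proj (SkewBrace.star a b) = SkewBrace.star (I.proj a) (I.proj b) := by
  simp only [SkewBrace.star, map_sub, map_add, map_neg, proj_mul]

end BraceIdeal

namespace SkewBrace

open scoped addCommutatorElement

section Supersoluble

variable {B : Type*} [SkewBrace B]

theorem fg_of_le_of_isAddCyclic_factor {I J : BraceIdeal B} [IsAddCyclic (factor I J)]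
    (hI : ∀ H ≤ I.toAddSubgroup, H.FG) {H : AddSubgroup B} (hH : H ≤ J.toAddSubgroup) : H.FG :=
  fg_of_fg_map_of_fg_inf_ker I.proj
    (fg_of_le_of_isAddCyclic (C := factor I J) (AddSubgroup.map_mono hH))
    (hI _ (I.ker_proj ▸ inf_le_right))

theorem IsSupersoluble.isNoetherianAddGroup (hB : IsSupersoluble B) : IsNoetherianAddGroup B := by
  obtain ⟨m, I, h0, hm, hI⟩ := hB
  have hcyclic : ∀ i < m, IsAddCyclic (factor (I i) (I (i + 1))) := fun i hi => by
    rcases (hI i hi).2 with ⟨hcyc, -, -⟩ | hprime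
    · exact hcyc
    · have := Fact.mk hprime
      exact isAddCyclic_of_prime_card rfl
  have hfg : ∀ i ≤ m, ∀ H ≤ (I i).toAddSubgroup, H.FG := fun i => by
    induction i with
    | zero => exact fun _ H hH => (le_bot_iff.mp (h0 ▸ hH)) ▸ AddSubgroup.FG.bot
    | succ i ih =>
      intro hi H hH
      have := hcyclic i hi
      exact fg_of_le_of_isAddCyclic_factor (ih (Nat.le_of_succ_le hi)) hH
  exact fun H => hfg m le_rfl H (hm ▸ le_top)

end Supersoluble

section Commutator

variable {B : Type*} [SkewBrace B]

/-- The commutator `[I, B]` of skew braces, so that `Γ_{n+1}(B) = [Γ_n(B), B]`. The condition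
`[I, B] ≤ I` characterises the ideals among the additive subgroups, and serves as such below. -/
def commutator (I : AddSubgroup B) : AddSubgroup B :=
  starSubgroup (I : Set B) Set.univ ⊔ starSubgroup Set.univ (I : Set B) ⊔ ⁅I, (⊤ : AddSubgroup B)⁆

theorem commutator_le {I K : AddSubgroup B} :
    commutator I ≤ K ↔ ∀ x ∈ I, ∀ b, star x b ∈ K ∧ star b x ∈ K ∧ ⁅x, b⁆ ∈ K := by
  simp only [commutator, starSubgroup, sup_le_iff, AddSubgroup.closure_le,
    AddSubgroup.addCommutator_le, Set.subset_def, Set.mem_ofPred_eq, SetLike.mem_coe, Set.mem_univ,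
    AddSubgroup.mem_top]
  grind

theorem commutator_mono {I J : AddSubgroup B} (h : I ≤ J) : commutator I ≤ commutator J :=
  commutator_le.mpr fun x hx => commutator_le.mp le_rfl x (h hx)

theorem map_commutator (J : BraceIdeal B) (I : AddSubgroup B) :
    (commutator I).map J.proj = commutator (I.map J.proj) := by
  refine le_antisymm ?_ (commutator_le.mpr ?_)
  · refine AddSubgroup.map_le_iff_le_comap.mpr (commutator_le.mpr fun x hx b => ?_)
    simpa only [AddSubgroup.mem_comap, J.proj_star, map_addCommutatorElement] using
      commutator_le.mp le_rfl _ (AddSubgroup.mem_map_of_mem J.proj hx) (J.proj b)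
  · rintro _ ⟨x, hx, rfl⟩ b
    obtain ⟨b, rfl⟩ := J.proj_surjective b
    obtain ⟨hxb, hbx, hadd⟩ := commutator_le.mp le_rfl x hx b
    exact ⟨⟨_, hxb, J.proj_star x b⟩, ⟨_, hbx, J.proj_star b x⟩,
      ⟨_, hadd, map_addCommutatorElement J.proj x b⟩⟩

theorem commutator_gammaSeries_le (n : ℕ) :
    commutator (gammaSeries B (n + 1)) ≤ gammaSeries B (n + 1) := by
  induction n with
  | zero => exact le_top
  | succ n ih => exact commutator_mono ih

variable {I : AddSubgroup B}

theorem lam_mem_of_commutator_le (hI : commutator I ≤ I) {x : B} (hx : x ∈ I) (b : B) :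
    lam b x ∈ I := by
  have h := I.add_mem (commutator_le.mp hI x hx b).2.1 hx
  rwa [star, sub_add_cancel] at h

theorem add_conj_mem_of_commutator_le (hI : commutator I ≤ I) {x : B} (hx : x ∈ I) (b : B) :
    b + x + -b ∈ I := by
  have h := I.add_mem (I.neg_mem (commutator_le.mp hI x hx b).2.2) hx
  simpa [addCommutatorElement_def, add_assoc] using h

theorem pow_mem_of_commutator_le (hI : commutator I ≤ I) {x : B} (hx : x ∈ I) (j : ℕ) :
    x ^ j ∈ I := by
  induction j with
  | zero => simp [one_eq_zero]
  | succ j ih =>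
    rw [pow_succ, mul_eq]
    exact I.add_mem ih (lam_mem_of_commutator_le hI hx _)

end Commutator

section CenterByFinite

variable {B : Type*} [SkewBrace B] {I : AddSubgroup B}

theorem center_le_addSubgroupCenter : (center B).toAddSubgroup ≤ AddSubgroup.center B :=
  fun _ hx => AddSubgroup.mem_center_iff.mpr fun b => (hx.1.2 b).symm

/-- The index of `I ∩ ζ(B)` in `(I, +)`, or `0` if that index is infinite. Multiplication by it is a
homomorphism from `(I, +)` to `ζ(B)`. -/
noncomputable def centralIndex (I : AddSubgroup B) : ℕ :=
  (center B).toAddSubgroup.relIndex I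

theorem centralIndex_nsmul_mem {x : B} (hx : x ∈ I) : centralIndex I • x ∈ centerSet B :=
  (center B).toAddSubgroup.nsmul_relIndex_mem hx

theorem centralIndex_nsmul_add {x y : B} (hx : x ∈ I) (hy : y ∈ I) :
    centralIndex I • (x + y) = centralIndex I • x + centralIndex I • y :=
  relIndex_nsmul_add center_le_addSubgroupCenter hx hy

theorem lam_nsmul (a : B) (k : ℕ) (b : B) : lam a (k • b) = k • lam a b :=
  map_nsmul (AddMonoidHom.mk' (lam a) (lam_add a)) k b

theorem star_mul (x y b : B) :
    star (x * y) b = star x (star y b) + star y b + star x b := by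
  have hy : lam y b = star y b + b := by rw [star, lam, sub_add_cancel]
  calc star (x * y) b = lam x (lam y b) - b := by rw [← lam_mul]; rfl
    _ = lam x (star y b) + (lam x b - b) := by rw [hy, lam_add, add_sub_assoc]
    _ = star x (star y b) + star y b + star x b := by simp only [star, lam, sub_add_cancel]

theorem centralIndex_nsmul_star_right (hI : commutator I ≤ I) {x : B} (hx : x ∈ I) (b : B) :
    centralIndex I • star b x = 0 :=
  calc centralIndex I • star b x
      = centralIndex I • (lam b x + -x) := by rw [← sub_eq_add_neg]; rfl
    _ = lam b (centralIndex I • x) + -(centralIndex I • x) := by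
      rw [centralIndex_nsmul_add (lam_mem_of_commutator_le hI hx b) (I.neg_mem hx), lam_nsmul,
        neg_nsmul]
    _ = 0 := by rw [lam_of_mem (centralIndex_nsmul_mem hx), add_neg_cancel]

theorem centralIndex_nsmul_addCommutator (hI : commutator I ≤ I) {x : B} (hx : x ∈ I) (b : B) :
    centralIndex I • ⁅x, b⁆ = 0 :=
  calc
    centralIndex I • ⁅x, b⁆ = centralIndex I • (x + (b + -x + -b)) := by
      simp only [addCommutatorElement_def, add_assoc]
    _ = centralIndex I • x + (b + centralIndex I • (-x) + -b) := by
      rw [centralIndex_nsmul_add hx (add_conj_mem_of_commutator_le hI (I.neg_mem hx) b)]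
      exact congrArg _ (map_nsmul (AddAut.addConj b) _ _).symm
    _ = 0 := by
      rw [← (centralIndex_nsmul_mem (I.neg_mem hx)).1.2 b, add_neg_cancel_right, neg_nsmul,
        add_neg_cancel]

theorem centralIndex_nsmul_star_pow (hI : commutator I ≤ I) {x : B} (hx : x ∈ I) (b : B)
    (j : ℕ) : centralIndex I • star (x ^ j) b = j • centralIndex I • star x b := by
  have star_mem {y : B} (hy : y ∈ I) (c : B) : star y c ∈ I := (commutator_le.mp hI y hy c).1
  induction j with
  | zero =>
    have hone : star 1 b = 0 := by rw [star, one_mul, one_eq_zero, neg_zero, zero_add, sub_self]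
    rw [pow_zero, hone, nsmul_zero, zero_nsmul]
  | succ j ih =>
    have hj := pow_mem_of_commutator_le hI hx j
    have hs := star_mem hx b
    rw [pow_succ, star_mul,
      centralIndex_nsmul_add (I.add_mem (star_mem hj _) hs) (star_mem hj b),
      centralIndex_nsmul_add (star_mem hj _) hs, centralIndex_nsmul_star_right hI hs, zero_add, ih,
      succ_nsmul']

theorem exists_pow_mem_centerSet (hI : commutator I ≤ I) (hindex : centralIndex I ≠ 0) {x : B}
    (hx : x ∈ I) : ∃ m ≠ 0, x ^ m ∈ centerSet B := by
  have hfin : (I.map (center B).proj : Set (center B).Quotient).Finite := by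
    rw [centralIndex, ← BraceIdeal.ker_proj, AddSubgroup.relIndex_ker] at hindex
    exact Nat.finite_of_card_ne_zero hindex
  obtain ⟨i, j, hij, heq⟩ := hfin.exists_lt_map_eq_of_forall_mem
    (f := fun k : ℕ => (center B).proj (x ^ k))
    fun k => AddSubgroup.mem_map_of_mem _ (pow_mem_of_commutator_le hI hx k)
  refine ⟨j - i, Nat.sub_ne_zero_of_lt hij, ?_⟩
  have hmem := (center B).proj_eq_iff.mp heq
  rwa [← pow_mul_pow_sub x hij.le, inv_mul_cancel_left] at hmem

theorem isOfFinAddOrder_star (hI : commutator I ≤ I) (hindex : centralIndex I ≠ 0) {x : B}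
    (hx : x ∈ I) (b : B) : IsOfFinAddOrder (star x b) := by
  obtain ⟨m, hm, hcentral⟩ := exists_pow_mem_centerSet hI hindex hx
  have hstar : star (x ^ m) b = 0 := by
    rw [star, mul_eq, hcentral.1.1, neg_add_cancel_left, sub_self]
  have hzero : m • centralIndex I • star x b = 0 := by
    rw [← centralIndex_nsmul_star_pow hI hx, hstar, nsmul_zero]
  exact isOfFinAddOrder_iff_nsmul_eq_zero.mpr
    ⟨m * centralIndex I, Nat.pos_of_ne_zero (mul_ne_zero hm hindex), by rw [mul_nsmul', hzero]⟩

theorem commutator_le_torsion (hI : commutator I ≤ I) (hindex : centralIndex I ≠ 0) :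
    commutator I ≤ torsionOfLECenter center_le_addSubgroupCenter hindex := by
  have htors {y : B} (hy : centralIndex I • y = 0) : IsOfFinAddOrder y :=
    isOfFinAddOrder_iff_nsmul_eq_zero.mpr ⟨_, Nat.pos_of_ne_zero hindex, hy⟩
  refine commutator_le.mpr fun x hx b => ?_
  obtain ⟨hxb, hbx, hadd⟩ := commutator_le.mp hI x hx b
  exact ⟨⟨hxb, isOfFinAddOrder_star hI hindex hx b⟩,
    ⟨hbx, htors (centralIndex_nsmul_star_right hI hx b)⟩,
    ⟨hadd, htors (centralIndex_nsmul_addCommutator hI hx b)⟩⟩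

theorem finite_commutator (hB : IsNoetherianAddGroup B) (hI : commutator I ≤ I)
    (hindex : centralIndex I ≠ 0) : Finite (commutator I) := by
  refine hB.finite_of_relIndex_ne_zero center_le_addSubgroupCenter ?_ fun x hx =>
    (commutator_le_torsion hI hindex hx).2
  exact mt (AddSubgroup.relIndex_eq_zero_of_le_right hI) hindex

end CenterByFinite

section CentralSeries

variable {B : Type*} [SkewBrace B]

theorem centralIndex_map_proj (m : ℕ) (I : AddSubgroup B) :
    centralIndex (I.map (zetaSeries B m).proj) = (zetaSeries B (m + 1)).toAddSubgroup.relIndex I :=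
  (AddSubgroup.relIndex_comap _ _ I).symm

theorem relIndex_zetaSeries_gammaSeries_ne_zero (hB : IsNoetherianAddGroup B) (j m : ℕ)
    (hfin : Finite (zetaSeries B (m + j)).Quotient) :
    (zetaSeries B m).toAddSubgroup.relIndex (gammaSeries B (j + 1)) ≠ 0 := by
  induction j generalizing m with
  | zero =>
    have : (zetaSeries B m).toAddSubgroup.FiniteIndex :=
      AddSubgroup.finiteIndex_iff_finite_quotient.mpr hfin
    exact (AddSubgroup.relIndex_top_right _).trans_ne this.index_ne_zero
  | succ j ih =>
    let Z := zetaSeries B m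
    let I := (gammaSeries B (j + 1)).map Z.proj
    have hideal : commutator I ≤ I :=
      map_commutator Z _ ▸ AddSubgroup.map_mono (commutator_gammaSeries_le j)
    have hindex : centralIndex I ≠ 0 := by
      rw [centralIndex_map_proj]
      exact ih (m + 1) (by rwa [Nat.add_right_comm])
    have hcomm : Finite (commutator I) :=
      finite_commutator (hB.of_surjective Z.proj_surjective) hideal hindex
    change Z.toAddSubgroup.relIndex (commutator _) ≠ 0
    rw [← Z.ker_proj, AddSubgroup.relIndex_ker, map_commutator]
    exact Nat.card_pos.ne'

end CentralSeries

end SkewBrace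

theorem theorem3p42_general {B : Type*} [SkewBrace B] (hB : IsNoetherianAddGroup B) (n : ℕ)
    (hn : Finite (SkewBrace.zetaSeries B n).Quotient) :
    Finite (SkewBrace.gammaSeries B (n + 1)) := by
  have hindex := SkewBrace.relIndex_zetaSeries_gammaSeries_ne_zero hB n 0 (by rwa [Nat.zero_add])
  exact Nat.finite_of_card_ne_zero ((AddSubgroup.relIndex_bot_left _).symm.trans_ne hindex)

theorem theorem3p42 {B : Type*} [SkewBrace B] (hB : SkewBrace.IsSupersoluble B) (n : ℕ)
    (hn : Finite (SkewBrace.zetaSeries B n).Quotient) :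
    Finite (SkewBrace.gammaSeries B (n + 1)) :=
  theorem3p42_general hB.isNoetherianAddGroup n hn
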